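/- Let $\mathcal X,\mathcal Y$ be compact Hausdorff spaces (for instance compact subsets of $\mathbb R^D$). For such a space $\mathcal S$ let $\mathcal C(\mathcal S)$ be the space of continuous real functions, $\mathcal M(\mathcal S)$ its dual, the space of finite signed (regular) Borel measures on $\mathcal S$, with the weak-$*$ topology, and $\mathcal P(\mathcal S)\subset\mathcal M(\mathcal S)$ the set of (regular) Borel probability measures; regularity is automatic if $\mathcal S$ is metrizable. Let $\mathbb P\in\mathcal P(\mathcal X)$, $\mathbb Q\in\mathcal P(\mathcal Y)$. Let $\Pi(\mathbb P)\subset\mathcal P(\mathcal X\times\mathcal Y)$ be the set of probability measures with first marginal $\mathbb P$, and $\Pi(\mathbb P,\mathbb Q)\subset\Pi(\mathbb P)$ the set of those whose second marginal is $\mathbb Q$. Let $\mathcal F:\mathcal M(\mathcal X\times\mathcal Y)\to\mathbb R\cup\{+\infty\}$ be a convex, weak-$*$ lower semi-continuous functional with $\mathcal F(\pi)<\infty$ for some $\pi\in\Pi(\mathbb P,\mathbb Q)$, and let $\mathcal F^*(h)=\sup_{\pi\in\mathcal M(\mathcal X\times\mathcal Y)}\big[\int h\,d\pi-\mathcal F(\pi)\big]$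 be its convex conjugate on $\mathcal C(\mathcal X\times\mathcal Y)$. Suppose that $\mathcal F$ is separably $*$-increasing: for all $u\in\mathcal C(\mathcal X)$, $v\in\mathcal C(\mathcal Y)$, $c\in\mathcal C(\mathcal X\times\mathcal Y)$ such that $u(x)+v(y)\le c(x,y)$ for all $(x,y)$, one has $\mathcal F^*(u\oplus v)\le\mathcal F^*(c)$, where $(u\oplus v)(x,y)=u(x)+v(y)$. Then $$\inf_{\pi\in\Pi(\mathbb P,\mathbb Q)}\mathcal F(\pi)=\sup_{v\in\mathcal C(\mathcal Y)}\ \inf_{\pi\in\Pi(\mathbb P)}\mathcal L(v,\pi),\qquad \mathcal L(v,\pi)=\Big[\mathcal F(\pi)-\int_{\mathcal Y}v(y)\,d\pi_y(y)\Big]+\int_{\mathcal Y}v(y)\,d\mathbb Q(y),$$ where $\pi_y$ is the marginal of $\pi$ on $\mathcal Y$. -/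

import Mathlib

open MeasureTheory

noncomputable section

namespace GeneralOT

section Measures

variable (S : Type*) [TopologicalSpace S] [MeasurableSpace S] [BorelSpace S]

/-- A measure dominated by a finite regular measure is regular. -/
theorem regular_of_le {S : Type*} [TopologicalSpace S] [T2Space S] [MeasurableSpace S]
    [BorelSpace S] {μ ν : Measure S} [IsFiniteMeasure ν] [ν.Regular] (h : μ ≤ ν) :
    μ.Regular := by
  have : IsFiniteMeasure μ := isFiniteMeasure_of_le ν h
  have : μ.InnerRegular := by
    refine ⟨fun A hA r hr => ?_⟩
    have hpos : μ A - r ≠ 0 := (tsub_pos_of_lt hr).ne'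
    obtain ⟨K, hKA, hK, hlt⟩ := hA.exists_isCompact_sdiff_lt (μ := ν) (measure_ne_top ν A) hpos
    refine ⟨K, hKA, hK, ?_⟩
    by_contra hcon
    have h1 : μ A ≤ μ K + μ (A \ K) := by
      have := measure_union_le (μ := μ) K (A \ K)
      rwa [Set.union_sdiff_cancel hKA] at this
    have h2 : μ (A \ K) < μ A - r := lt_of_le_of_lt (h _) hlt
    have h3 : μ A < r + (μ A - r) :=
      calc μ A ≤ μ K + μ (A \ K) := h1
        _ ≤ r + μ (A \ K) := by gcongr; exact not_lt.mp hcon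
        _ < r + (μ A - r) := (ENNReal.add_lt_add_iff_left hr.ne_top).2 h2
    rw [add_tsub_cancel_of_le hr.le] at h3
    exact lt_irrefl _ h3
  infer_instance

/-- The variation of a signed measure is finite. -/
theorem isFiniteMeasure_variation {S : Type*} [MeasurableSpace S] (μ : SignedMeasure S) :
    IsFiniteMeasure μ.variation := by
  rw [← SignedMeasure.totalVariation_eq_variation]
  unfold SignedMeasure.totalVariation
  infer_instance

variable [T2Space S]

/-- The space `ℳ(S)` of finite signed Borel measures on `S`. As usual on a Hausdorff space, these
are the regular (Radon) ones; for compact `S` this is the dual space of `C(S, ℝ)`. On a compact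
metrizable space every finite signed Borel measure is regular. -/
def RadonSigned : Submodule ℝ (SignedMeasure S) where
  carrier := {μ | μ.variation.Regular}
  zero_mem' := by
    change (VectorMeasure.variation (0 : SignedMeasure S)).Regular
    rw [VectorMeasure.variation_zero]
    infer_instance
  add_mem' := by
    intro μ ν hμ hν
    have : μ.variation.Regular := hμ
    have : ν.variation.Regular := hν
    have := isFiniteMeasure_variation μ
    have := isFiniteMeasure_variation ν
    have : (μ.variation + ν.variation).Regular := by
      have : (μ.variation + ν.variation).InnerRegular := inferInstance
      infer_instance
    exact regular_of_le VectorMeasure.variation_add_le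
  smul_mem' := by
    intro c μ hμ
    have : μ.variation.Regular := hμ
    change (VectorMeasure.variation (c • μ)).Regular
    rw [VectorMeasure.variation_smul]
    exact Measure.Regular.smul ENNReal.coe_ne_top

/-- The set `𝒫(S)` of (regular) Borel probability measures on `S`. -/
def RadonProb : Type _ := {μ : Measure S // IsProbabilityMeasure μ ∧ μ.Regular}

variable {S}

instance : Coe (RadonProb S) (Measure S) := ⟨fun μ => μ.1⟩

instance (μ : RadonProb S) : IsProbabilityMeasure μ.1 := μ.2.1

instance (μ : RadonProb S) : μ.1.Regular := μ.2.2

/-- The inclusion `𝒫(S) ⊆ ℳ(S)`. -/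
def RadonProb.toSigned (μ : RadonProb S) : RadonSigned S :=
  ⟨μ.1.toSignedMeasure, by
    change (VectorMeasure.variation μ.1.toSignedMeasure).Regular
    rw [Measure.variation_toSignedMeasure]
    infer_instance⟩

/-- The pairing `∫ h dμ` of `h ∈ C(S)` with `μ ∈ ℳ(S)`. -/
def pairing (h : C(S, ℝ)) (μ : RadonSigned S) : ℝ :=
  VectorMeasure.integral (μ : SignedMeasure S) (fun s => h s) (ContinuousLinearMap.lsmul ℝ ℝ).flip

/-- The weak-* topology on `ℳ(S)`: the coarsest one for which `μ ↦ ∫ h dμ` is continuous for all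
`h ∈ C(S)`. -/
instance weakStarTopology : TopologicalSpace (RadonSigned S) :=
  TopologicalSpace.induced (fun μ (h : C(S, ℝ)) => pairing h μ) inferInstance

/-- Convexity of a functional `F : ℳ(S) → ℝ ∪ {+∞}`. -/
def IsConvex (F : RadonSigned S → EReal) : Prop :=
  ∀ μ ν : RadonSigned S, ∀ a b : ℝ, 0 < a → 0 < b → a + b = 1 →
    F (a • μ + b • ν) ≤ (a : EReal) * F μ + (b : EReal) * F ν

/-- The convex conjugate `F* (h) = sup_μ [∫ h dμ - F(μ)]`, the supremum being over `ℳ(S)`. -/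
def conjugate (F : RadonSigned S → EReal) (h : C(S, ℝ)) : EReal :=
  ⨆ μ : RadonSigned S, ((pairing h μ : ℝ) : EReal) - F μ

end Measures

section Transport

variable {X Y : Type*} [TopologicalSpace X] [T2Space X] [MeasurableSpace X] [BorelSpace X]
  [TopologicalSpace Y] [T2Space Y] [MeasurableSpace Y] [BorelSpace Y]
  [MeasurableSpace (X × Y)] [BorelSpace (X × Y)]

/-- The function `u ⊕ v : (x, y) ↦ u x + v y`. -/
def oplus (u : C(X, ℝ)) (v : C(Y, ℝ)) : C(X × Y, ℝ) where
  toFun p := u p.1 + v p.2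
  continuous_toFun := by fun_prop

/-- `F` is separably *-increasing: `u ⊕ v ≤ c` implies `F*(u ⊕ v) ≤ F*(c)`. -/
def SeparablyStarIncreasing (F : RadonSigned (X × Y) → EReal) : Prop :=
  ∀ (u : C(X, ℝ)) (v : C(Y, ℝ)) (c : C(X × Y, ℝ)), (∀ p, oplus u v p ≤ c p) →
    conjugate F (oplus u v) ≤ conjugate F c

/-- `Π(P)`: the probability measures on `X × Y` with first marginal `P`. -/
def plansFst (P : RadonProb X) : Set (RadonProb (X × Y)) :=
  {π | π.1.map Prod.fst = P.1}

/-- `Π(P, Q)`: the transport plans between `P` and `Q`. -/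
def plans (P : RadonProb X) (Q : RadonProb Y) : Set (RadonProb (X × Y)) :=
  {π | π.1.map Prod.fst = P.1 ∧ π.1.map Prod.snd = Q.1}

/-- The general optimal transport cost `inf_{π ∈ Π(P, Q)} F(π)`. -/
def cost (F : RadonSigned (X × Y) → EReal) (P : RadonProb X) (Q : RadonProb Y) : EReal :=
  ⨅ π ∈ plans P Q, F π.toSigned

/-- The functional `L(v, π) = [F(π) - ∫ v dπ_y] + ∫ v dQ`, where `π_y` is the marginal of `π`
on `Y`. -/
def lagrangian (F : RadonSigned (X × Y) → EReal) (Q : RadonProb Y) (v : C(Y, ℝ))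
    (π : RadonProb (X × Y)) : EReal :=
  (F π.toSigned - ((∫ y, v y ∂(π.1.map Prod.snd) : ℝ) : EReal)) + ((∫ y, v y ∂Q.1 : ℝ) : EReal)

end Transport

end GeneralOT

end

/-! The constraint `π_y = Q` is imposed by a Lagrange multiplier `v`. For `π ∈ Π(P)` the defect `∫ v
dQ - ∫ v dπ_y` is linear in `v`, so the supremum over `v` of `F(π)` plus the defect is `F(π)` if
`π_y = Q` and `+∞` otherwise. The cost is therefore an inf-sup over `Π(P) × C(Y)`
(`iInf_iSup_lagrangian_eq_cost`), and the theorem says that inf and sup may be exchanged.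

Sion's minimax theorem allows this: `Π(P)` is convex and weak-* compact (`convex_plansFst`,
`isCompact_plansFst`), and the Lagrangian is convex and lower semicontinuous in `π`, affine and
continuous in `v`. Only one side has to be compact, so the whole space `C(Y)` is admissible. -/

noncomputable section

namespace GeneralOT

/-! ### Weak-* topology and compactness for regular measures -/

section RadonMeasures

variable {S : Type*} [TopologicalSpace S] [T2Space S] [MeasurableSpace S] [BorelSpace S]

theorem continuous_pairing (h : C(S, ℝ)) : Continuous (pairing h : RadonSigned S → ℝ) :=
  (continuous_apply (A := fun _ => ℝ) h).comp
    (continuous_induced_dom (f := fun (μ : RadonSigned S) (h : C(S, ℝ)) => pairing h μ))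

theorem pairing_toSigned (h : C(S, ℝ)) (μ : RadonProb S) :
    pairing h μ.toSigned = ∫ s, h s ∂μ.1 :=
  VectorMeasure.integral_toSignedMeasure

theorem pairing_smul (h : C(S, ℝ)) (c : ℝ) (μ : RadonSigned S) :
    pairing h (c • μ) = c * pairing h μ :=
  VectorMeasure.integral_smul_vectorMeasure _ _

/-- A convex combination of regular Borel probability measures is one. -/
theorem exists_toSigned_eq_convexCombination (μ ν : RadonProb S) {a b : ℝ} (ha : 0 ≤ a)
    (hb : 0 ≤ b) (hab : a + b = 1) :
    ∃ ρ : RadonProb S, ρ.1 = a.toNNReal • μ.1 + b.toNNReal • ν.1 ∧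
      ρ.toSigned = a • μ.toSigned + b • ν.toSigned := by
  have hprob : IsProbabilityMeasure (a.toNNReal • μ.1 + b.toNNReal • ν.1) := by
    constructor
    simp only [Measure.coe_add, Pi.add_apply, Measure.smul_apply, measure_univ]
    simp only [ENNReal.smul_def, smul_eq_mul, mul_one]
    rw [← ENNReal.coe_add, ← Real.toNNReal_add ha hb, hab]
    simp
  have hreg : (a.toNNReal • μ.1 + b.toNNReal • ν.1).Regular := by
    have h₁ : (a.toNNReal • μ.1).Regular := Measure.Regular.smul ENNReal.coe_ne_top
    have h₂ : (b.toNNReal • ν.1).Regular := Measure.Regular.smul ENNReal.coe_ne_top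
    have : (a.toNNReal • μ.1 + b.toNNReal • ν.1).InnerRegular := inferInstance
    infer_instance
  refine ⟨⟨_, hprob, hreg⟩, rfl, Subtype.ext ?_⟩
  change (a.toNNReal • μ.1 + b.toNNReal • ν.1).toSignedMeasure
    = a • μ.1.toSignedMeasure + b • ν.1.toSignedMeasure
  rw [Measure.toSignedMeasure_add, Measure.toSignedMeasure_smul, Measure.toSignedMeasure_smul]
  simp only [NNReal.smul_def, Real.coe_toNNReal a ha, Real.coe_toNNReal b hb]

variable [CompactSpace S]

theorem integrable_of_continuousMap (h : C(S, ℝ)) (μ : Measure S) [IsFiniteMeasure μ] :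
    Integrable h μ :=
  h.continuous.integrable_of_hasCompactSupport (HasCompactSupport.of_compactSpace _)

theorem pairing_add (h : C(S, ℝ)) (μ ν : RadonSigned S) :
    pairing h (μ + ν) = pairing h μ + pairing h ν := by
  have := isFiniteMeasure_variation (μ : SignedMeasure S)
  have := isFiniteMeasure_variation (ν : SignedMeasure S)
  exact VectorMeasure.integral_add_vectorMeasure (integrable_of_continuousMap h _)
    (integrable_of_continuousMap h _)

/-- The pairing as a linear map into the functions on `C(S, ℝ)`. -/
def pairingLinearMap (S : Type*) [TopologicalSpace S] [T2Space S] [MeasurableSpace S]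
    [BorelSpace S] [CompactSpace S] : RadonSigned S →ₗ[ℝ] (C(S, ℝ) → ℝ) where
  toFun μ h := pairing h μ
  map_add' μ ν := funext fun h => pairing_add h μ ν
  map_smul' c μ := funext fun h => pairing_smul h c μ

instance : IsTopologicalAddGroup (RadonSigned S) :=
  topologicalAddGroup_induced (pairingLinearMap S)

instance : ContinuousSMul ℝ (RadonSigned S) :=
  continuousSMul_induced (pairingLinearMap S)

theorem integral_add_smul_measure (h : C(S, ℝ)) (μ ν : Measure S) [IsFiniteMeasure μ]
    [IsFiniteMeasure ν] (a b : NNReal) :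
    ∫ s, h s ∂(a • μ + b • ν) = a * ∫ s, h s ∂μ + b * ∫ s, h s ∂ν := by
  rw [integral_add_measure (integrable_of_continuousMap h _) (integrable_of_continuousMap h _),
    integral_smul_nnreal_measure, integral_smul_nnreal_measure]
  rfl

/-- Uniqueness in the Riesz representation theorem; this is where regularity matters. -/
theorem ext_of_forall_integral_eq {μ ν : Measure S} [IsFiniteMeasure μ] [IsFiniteMeasure ν]
    [μ.Regular] [ν.Regular] (h : ∀ u : C(S, ℝ), ∫ s, u s ∂μ = ∫ s, u s ∂ν) : μ = ν :=
  Measure.ext_of_integral_eq_on_compactlySupported fun f => h ⟨f, f.continuous⟩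

/-- On a compact space every Borel probability measure agrees on continuous functions with a
regular one. -/
theorem exists_radonProb_integral_eq (μ : ProbabilityMeasure S) :
    ∃ ν : RadonProb S, ∀ h : C(S, ℝ), ∫ s, h s ∂(μ : Measure S) = ∫ s, h s ∂ν.1 := by
  obtain ⟨ν, hreg, hfin, hν⟩ := Measure.exists_regular_eq_of_compactSpace (μ : Measure S)
  have hν' (h : C(S, ℝ)) : ∫ s, h s ∂(μ : Measure S) = ∫ s, h s ∂ν :=
    hν (BoundedContinuousFunction.mkOfCompact h)
  have hprob : IsProbabilityMeasure ν := by
    -- Testing against the constant `1` gives the total mass.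
    have h1 := hν' 1
    simp only [ContinuousMap.one_apply, integral_const, smul_eq_mul, mul_one, probReal_univ] at h1
    exact ⟨by rw [← ENNReal.toReal_eq_one_iff]; exact h1.symm⟩
  exact ⟨⟨ν, hprob, hreg⟩, hν'⟩

/-- The regular probability measures satisfying a family of linear equations
`∫ h i dμ = c i` form a weak-* compact set. -/
theorem isCompact_toSigned_image {ι : Type*} (h : ι → C(S, ℝ)) (c : ι → ℝ) :
    IsCompact (RadonProb.toSigned '' {μ : RadonProb S | ∀ i, ∫ s, h i s ∂μ.1 = c i}) := by
  -- `ProbabilityMeasure S` is compact but may contain non-regular measures. The regularisation `Φ`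
  -- preserves integrals of continuous functions, so it is weak-* continuous and carries the closed
  -- solution set of the equations onto the set in question.
  choose Φ hΦ using exists_radonProb_integral_eq (S := S)
  have hint (u : C(S, ℝ)) :
      Continuous fun μ : ProbabilityMeasure S => ∫ s, u s ∂(μ : Measure S) :=
    ProbabilityMeasure.continuous_integral_boundedContinuousFunction
      (BoundedContinuousFunction.mkOfCompact u)
  have hcont : Continuous fun μ => (Φ μ).toSigned := by
    refine continuous_induced_rng.2 (continuous_pi fun u => ?_)
    simpa only [Function.comp_def, pairing_toSigned, ← hΦ] using hint u
  have hclosed : IsClosed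
      {μ : ProbabilityMeasure S | ∀ i, ∫ s, h i s ∂(μ : Measure S) = c i} := by
    rw [Set.ofPred_forall]
    exact isClosed_iInter fun i => isClosed_eq (hint (h i)) continuous_const
  convert hclosed.isCompact.image hcont using 1
  ext μ
  constructor
  · rintro ⟨π, hπ, rfl⟩
    refine ⟨⟨π.1, π.2.1⟩, hπ, congrArg _ (Subtype.ext ?_)⟩
    -- `Φ` fixes measures that are already regular.
    exact ext_of_forall_integral_eq fun u => (hΦ ⟨π.1, π.2.1⟩ u).symm
  · rintro ⟨π, hπ, rfl⟩
    exact ⟨Φ π, fun i => (hΦ π (h i)).symm.trans (hπ i), rfl⟩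

theorem continuous_integral_continuousMap (μ : Measure S) [IsFiniteMeasure μ] :
    Continuous fun h : C(S, ℝ) => ∫ s, h s ∂μ := by
  refine LipschitzWith.continuous (K := (μ.real Set.univ).toNNReal)
    (LipschitzWith.of_dist_le_mul fun f g => ?_)
  rw [dist_eq_norm, ← integral_sub (integrable_of_continuousMap f μ)
    (integrable_of_continuousMap g μ), dist_eq_norm, Real.coe_toNNReal _ measureReal_nonneg,
    mul_comm]
  exact norm_integral_le_of_norm_le_const (.of_forall fun s => (f - g).norm_coe_le_norm s)

/-- The pushforward of a regular finite measure under a continuous map of compact spaces is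
determined by integrals of continuous functions. -/
theorem map_eq_iff_forall_integral_eq {T : Type*} [TopologicalSpace T] [T2Space T]
    [CompactSpace T] [MeasurableSpace T] [BorelSpace T] (φ : C(S, T)) (μ : RadonProb S)
    (ν : RadonProb T) :
    μ.1.map φ = ν.1 ↔ ∀ u : C(T, ℝ), ∫ s, u (φ s) ∂μ.1 = ∫ t, u t ∂ν.1 := by
  have hmap (u : C(T, ℝ)) : ∫ t, u t ∂(μ.1.map φ) = ∫ s, u (φ s) ∂μ.1 :=
    integral_map φ.continuous.aemeasurable u.continuous.aestronglyMeasurable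
  refine ⟨fun h u => by rw [← hmap, h], fun h => ?_⟩
  have : (μ.1.map φ).InnerRegular := Measure.InnerRegular.map_of_continuous φ.continuous
  exact ext_of_forall_integral_eq fun u => (hmap u).trans (h u)

end RadonMeasures

/-! ### Semicontinuity and quasiconvexity of `F + g` in `EReal` -/

section ShiftedFunctional

theorem sub_coe_add_coe (x : EReal) (a b : ℝ) : x - a + b = x + ((b - a : ℝ) : EReal) := by
  induction x with
  | bot => simp
  | top => rw [EReal.top_sub_coe, EReal.top_add_coe, EReal.top_add_coe]
  | coe x => norm_cast; ring

theorem lowerSemicontinuous_add_coe {E : Type*} [TopologicalSpace E] {F : E → EReal} {g : E → ℝ}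
    (hF : LowerSemicontinuous F) (hg : Continuous g) :
    LowerSemicontinuous fun x => F x + (g x : EReal) :=
  hF.add' (continuous_coe_real_ereal.comp hg).lowerSemicontinuous fun _ =>
    EReal.continuousAt_add (.inr (EReal.coe_ne_bot _)) (.inr (EReal.coe_ne_top _))

theorem upperSemicontinuous_const_add_coe {E : Type*} [TopologicalSpace E] (x : EReal) {g : E → ℝ}
    (hg : Continuous g) : UpperSemicontinuous fun y => x + (g y : EReal) :=
  UpperSemicontinuous.add' upperSemicontinuous_const
    (continuous_coe_real_ereal.comp hg).upperSemicontinuous fun _ =>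
    EReal.continuousAt_add (.inr (EReal.coe_ne_bot _)) (.inr (EReal.coe_ne_top _))

theorem quasiconcaveOn_const_add_coe {E : Type*} [AddCommGroup E] [Module ℝ E] (x : EReal)
    {g : E → ℝ} (hg : ∀ v w : E, ∀ a b : ℝ, a + b = 1 → g (a • v + b • w) = a * g v + b * g w) :
    QuasiconcaveOn ℝ Set.univ fun y => x + (g y : EReal) := by
  rintro r v ⟨-, hv⟩ w ⟨-, hw⟩ a b ha hb hab
  refine ⟨trivial, ?_⟩
  have hmin : min (g v) (g w) ≤ g (a • v + b • w) := by
    rw [hg v w a b hab]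
    have h₁ := mul_le_mul_of_nonneg_left (min_le_left (g v) (g w)) ha
    have h₂ := mul_le_mul_of_nonneg_left (min_le_right (g v) (g w)) hb
    calc min (g v) (g w) = a * min (g v) (g w) + b * min (g v) (g w) := by
          rw [← add_mul, hab, one_mul]
      _ ≤ _ := add_le_add h₁ h₂
  rcases min_choice (g v) (g w) with h | h <;> rw [h] at hmin
  · exact le_trans hv (add_le_add_right (EReal.coe_le_coe_iff.2 hmin) _)
  · exact le_trans hw (add_le_add_right (EReal.coe_le_coe_iff.2 hmin) _)

/-- Level `⊤` is trivial and level `⊥` is empty because `F` avoids `⊥`. A real level forces `F` to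
be finite at both points, so convexity becomes an inequality between reals. -/
theorem quasiconvexOn_add_coe {S : Type*} [TopologicalSpace S] [T2Space S] [MeasurableSpace S]
    [BorelSpace S] {K : Set (RadonSigned S)} (hK : Convex ℝ K) {F : RadonSigned S → EReal}
    (hbot : ∀ μ, F μ ≠ ⊥) (hF : IsConvex F) {g : RadonSigned S → ℝ}
    (hg : ∀ μ ν, ∀ a b : ℝ, a + b = 1 → g (a • μ + b • ν) = a * g μ + b * g ν) :
    QuasiconvexOn ℝ K fun μ => F μ + (g μ : EReal) := by
  rintro r
  rw [convex_iff_forall_pos]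
  rintro μ ⟨hμK, hμ⟩ ν ⟨hνK, hν⟩ a b ha hb hab
  refine ⟨hK hμK hνK ha.le hb.le hab, ?_⟩
  have hconv := hF μ ν a b ha hb hab
  simp only [hg μ ν a b hab]
  induction r with
  | top => exact le_top
  | bot =>
    rw [le_bot_iff, EReal.add_eq_bot_iff] at hμ
    exact absurd (hμ.resolve_right (EReal.coe_ne_bot _)) (hbot μ)
  | coe r =>
    have htop (ρ) (hρ : F ρ + (g ρ : EReal) ≤ r) : F ρ ≠ ⊤ := by
      intro h
      rw [h, EReal.top_add_coe] at hρ
      exact EReal.coe_ne_top r (top_le_iff.1 hρ)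
    lift F μ to ℝ using ⟨htop μ hμ, hbot μ⟩ with p
    lift F ν to ℝ using ⟨htop ν hν, hbot ν⟩ with q
    refine (add_le_add_left hconv _).trans ?_
    norm_cast at hμ hν ⊢
    calc a * p + b * q + (a * g μ + b * g ν) = a * (p + g μ) + b * (q + g ν) := by ring
      _ ≤ a * r + b * r := add_le_add (mul_le_mul_of_nonneg_left hμ ha.le)
          (mul_le_mul_of_nonneg_left hν hb.le)
      _ = r := by rw [← add_mul, hab, one_mul]

/-- A supremum over all scalings is infinite as soon as one increment is nonzero. -/
theorem iSup_add_coe_eq_top {E : Type*} [AddCommGroup E] [Module ℝ E] {x : EReal} (hx : x ≠ ⊥)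
    {g : E → ℝ} (hg : ∀ (c : ℝ) (v : E), g (c • v) = c * g v) {v : E} (hv : g v ≠ 0) :
    ⨆ w, x + (g w : EReal) = ⊤ := by
  rw [EReal.eq_top_iff_forall_lt]
  intro r
  induction x with
  | bot => exact absurd rfl hx
  | top =>
    refine lt_of_lt_of_le ?_ (le_iSup _ v)
    simp
  | coe x =>
    -- This scaling makes the value exactly `r + 1`.
    refine lt_of_lt_of_le ?_ (le_iSup _ (((r - x + 1) / g v) • v))
    rw [hg, div_mul_cancel₀ _ hv]
    norm_cast
    linarith

end ShiftedFunctional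

/-! ### Marginal constraints and the Lagrangian -/

section Transport

variable {X Y : Type*} [TopologicalSpace X] [CompactSpace X] [T2Space X] [MeasurableSpace X]
  [BorelSpace X] [TopologicalSpace Y] [CompactSpace Y] [T2Space Y] [MeasurableSpace Y]
  [BorelSpace Y] [MeasurableSpace (X × Y)] [BorelSpace (X × Y)]

/-- Linear equations in `π` against continuous functions make both compactness and convexity of
`Π(P)` accessible. -/
theorem plansFst_eq (P : RadonProb X) : plansFst (Y := Y) P =
    {π | ∀ u : C(X, ℝ), ∫ p, (u.comp ContinuousMap.fst) p ∂π.1 = ∫ x, u x ∂P.1} :=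
  Set.ext fun π => map_eq_iff_forall_integral_eq ContinuousMap.fst π P

theorem mem_plans_iff {P : RadonProb X} {Q : RadonProb Y} {π : RadonProb (X × Y)} :
    π ∈ plans P Q ↔ π ∈ plansFst P ∧
      ∀ v : C(Y, ℝ), ∫ p, (v.comp ContinuousMap.snd) p ∂π.1 = ∫ y, v y ∂Q.1 :=
  and_congr_right fun _ => map_eq_iff_forall_integral_eq ContinuousMap.snd π Q

theorem isCompact_plansFst (P : RadonProb X) :
    IsCompact (RadonProb.toSigned '' plansFst (Y := Y) P) := by
  rw [plansFst_eq]
  exact isCompact_toSigned_image _ _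

theorem convex_plansFst (P : RadonProb X) :
    Convex ℝ (RadonProb.toSigned '' plansFst (Y := Y) P) := by
  rintro _ ⟨μ, hμ, rfl⟩ _ ⟨ν, hν, rfl⟩ a b ha hb hab
  obtain ⟨ρ, hρ, hρ'⟩ := exists_toSigned_eq_convexCombination μ ν ha hb hab
  refine ⟨ρ, ?_, hρ'⟩
  rw [plansFst_eq] at hμ hν ⊢
  intro u
  rw [hρ, integral_add_smul_measure, hμ u, hν u, ← add_mul, Real.coe_toNNReal _ ha,
    Real.coe_toNNReal _ hb, hab, one_mul]

/-- The amount `∫ v dQ - ∫ v dμ_y` by which the second marginal of `μ` misses `Q` on `v`. -/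
def marginalDefect (Q : RadonProb Y) (μ : RadonSigned (X × Y)) (v : C(Y, ℝ)) : ℝ :=
  ∫ y, v y ∂Q.1 - pairing (v.comp ContinuousMap.snd) μ

theorem marginalDefect_toSigned (Q : RadonProb Y) (π : RadonProb (X × Y)) (v : C(Y, ℝ)) :
    marginalDefect Q π.toSigned v =
      ∫ y, v y ∂Q.1 - ∫ p, (v.comp ContinuousMap.snd) p ∂π.1 := by
  rw [marginalDefect, pairing_toSigned]

theorem lagrangian_eq (F : RadonSigned (X × Y) → EReal) (Q : RadonProb Y) (v : C(Y, ℝ))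
    (π : RadonProb (X × Y)) :
    lagrangian F Q v π = F π.toSigned + (marginalDefect Q π.toSigned v : EReal) := by
  rw [lagrangian, sub_coe_add_coe, marginalDefect_toSigned,
    integral_map (continuous_snd.aemeasurable) v.continuous.aestronglyMeasurable]
  rfl

/-- The constant `∫ v dQ` makes the defect affine rather than linear in `μ`, hence the need for `a +
b = 1`. -/
theorem marginalDefect_convexCombination (Q : RadonProb Y) (v : C(Y, ℝ))
    (μ ν : RadonSigned (X × Y)) (a b : ℝ) (hab : a + b = 1) :
    marginalDefect Q (a • μ + b • ν) v
      = a * marginalDefect Q μ v + b * marginalDefect Q ν v := by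
  simp only [marginalDefect, pairing_add, pairing_smul]
  linear_combination -(∫ y, v y ∂Q.1) * hab

theorem marginalDefect_smul (Q : RadonProb Y) (π : RadonProb (X × Y)) (c : ℝ) (v : C(Y, ℝ)) :
    marginalDefect Q π.toSigned (c • v) = c * marginalDefect Q π.toSigned v := by
  simp only [marginalDefect_toSigned, mul_sub, ← integral_const_mul]
  rfl

theorem marginalDefect_add (Q : RadonProb Y) (π : RadonProb (X × Y)) (v w : C(Y, ℝ)) :
    marginalDefect Q π.toSigned (v + w)
      = marginalDefect Q π.toSigned v + marginalDefect Q π.toSigned w := by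
  have h₁ : ∫ y, (v + w) y ∂Q.1 = ∫ y, v y ∂Q.1 + ∫ y, w y ∂Q.1 :=
    integral_add (integrable_of_continuousMap v _) (integrable_of_continuousMap w _)
  have h₂ : ∫ p, ((v + w).comp ContinuousMap.snd) p ∂π.1
      = ∫ p, (v.comp ContinuousMap.snd) p ∂π.1 + ∫ p, (w.comp ContinuousMap.snd) p ∂π.1 :=
    integral_add (integrable_of_continuousMap (v.comp ContinuousMap.snd) _)
      (integrable_of_continuousMap (w.comp ContinuousMap.snd) _)
  rw [marginalDefect_toSigned, marginalDefect_toSigned, marginalDefect_toSigned, h₁, h₂]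
  ring

theorem continuous_marginalDefect (Q : RadonProb Y) (π : RadonProb (X × Y)) :
    Continuous (marginalDefect Q π.toSigned) := by
  simp only [funext (marginalDefect_toSigned Q π)]
  exact (continuous_integral_continuousMap Q.1).sub ((continuous_integral_continuousMap π.1).comp
    (ContinuousMap.continuous_precomp ContinuousMap.snd))

theorem iInf_iSup_lagrangian_eq_cost (P : RadonProb X) (Q : RadonProb Y)
    {F : RadonSigned (X × Y) → EReal} (hF_bot : ∀ μ, F μ ≠ ⊥) :
    ⨅ π ∈ plansFst (Y := Y) P, ⨆ v : C(Y, ℝ),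
      (F π.toSigned + (marginalDefect Q π.toSigned v : EReal)) = cost F P Q := by
  refine le_antisymm (le_iInf₂ fun π hπ => ?_) (le_iInf₂ fun π hπ => ?_)
  · rw [mem_plans_iff] at hπ
    refine (iInf₂_le π hπ.1).trans (iSup_le fun v => ?_)
    rw [marginalDefect_toSigned, hπ.2 v]
    simp
  · by_cases h : ∃ v, marginalDefect Q π.toSigned v ≠ 0
    · obtain ⟨v, hv⟩ := h
      rw [iSup_add_coe_eq_top (hF_bot _) (marginalDefect_smul Q π) hv]
      exact le_top
    · push Not at h
      have hmem : π ∈ plans P Q := mem_plans_iff.2 ⟨hπ, fun v => by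
        have := h v
        rw [marginalDefect_toSigned] at this
        linarith⟩
      simpa [h, cost] using iInf₂_le (f := fun (π : RadonProb (X × Y)) (_ : π ∈ plans P Q) =>
        F π.toSigned) π hmem

end Transport

end GeneralOT

end

theorem theorem1 {X Y : Type*}
    [TopologicalSpace X] [CompactSpace X] [T2Space X] [MeasurableSpace X] [BorelSpace X]
    [TopologicalSpace Y] [CompactSpace Y] [T2Space Y] [MeasurableSpace Y] [BorelSpace Y]
    -- `X × Y` carries its Borel σ-algebra
    [MeasurableSpace (X × Y)] [BorelSpace (X × Y)]
    (P : GeneralOT.RadonProb X) (Q : GeneralOT.RadonProb Y)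
    (F : GeneralOT.RadonSigned (X × Y) → EReal)
    -- `F` takes values in `ℝ ∪ {+∞}`
    (hF_bot : ∀ μ, F μ ≠ ⊥)
    (hF_convex : GeneralOT.IsConvex F)
    -- lower semi-continuity in the weak-* topology
    (hF_lsc : LowerSemicontinuous F)
    (hF_incr : GeneralOT.SeparablyStarIncreasing F)
    -- some transport plan has finite cost
    (hF_feasible : ∃ π ∈ GeneralOT.plans P Q, F π.toSigned < ⊤) :
    GeneralOT.cost F P Q =
      ⨆ v : C(Y, ℝ), ⨅ π ∈ GeneralOT.plansFst (Y := Y) P, GeneralOT.lagrangian F Q v π := by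
  have hne : (GeneralOT.plansFst (Y := Y) P).Nonempty :=
    let ⟨π, hπ, _⟩ := hF_feasible
    ⟨π, hπ.1⟩
  -- `Π(P)` is weak-* compact, so Sion's theorem applies to it without using `hF_incr`.
  have hminimax := Sion.minimax' (X := GeneralOT.RadonProb.toSigned '' GeneralOT.plansFst (Y := Y) P)
    (Y := (Set.univ : Set C(Y, ℝ)))
    (f := fun μ v => F μ + (GeneralOT.marginalDefect Q μ v : EReal))
    (hne.image _) (GeneralOT.convex_plansFst P) (GeneralOT.isCompact_plansFst P)
    (fun v _ => (GeneralOT.lowerSemicontinuous_add_coe hF_lsc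
      (continuous_const.sub (GeneralOT.continuous_pairing _))).lowerSemicontinuousOn _)
    (fun v _ => GeneralOT.quasiconvexOn_add_coe (GeneralOT.convex_plansFst P) hF_bot hF_convex
      (GeneralOT.marginalDefect_convexCombination Q v))
    convex_univ
    (by
      rintro _ ⟨π, -, rfl⟩
      exact (GeneralOT.upperSemicontinuous_const_add_coe _
        (GeneralOT.continuous_marginalDefect Q π)).upperSemicontinuousOn _)
    (by
      rintro _ ⟨π, -, rfl⟩
      refine GeneralOT.quasiconcaveOn_const_add_coe _ fun v w a b _ => ?_
      rw [GeneralOT.marginalDefect_add, GeneralOT.marginalDefect_smul,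
        GeneralOT.marginalDefect_smul])
  simp only [iInf_image, Set.mem_univ, iSup_pos] at hminimax
  rw [GeneralOT.iInf_iSup_lagrangian_eq_cost P Q hF_bot] at hminimax
  simpa only [GeneralOT.lagrangian_eq] using hminimax
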